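/- For $n\in\mathbb{N}$ (with $n=0$ allowed) let $$\Delta^n=\{x=(x_1,\dots,x_n)\in\mathbb{R}^n : 0\le x_1\le x_2\le\dots\le x_n\le 1\},$$ and put $x_0=0$, $x_{n+1}=1$. For $x\in\Delta^n$ let $\Sigma_n(x)\in L^\infty[0,1]$ be the class of the function on $[0,1]$ that equals $(-1)^m$ on $[x_m,x_{m+1})$ for $0\le m\le n$ and equals $(-1)^n$ at $1$. Let $D_n=\{\Sigma_n(x) : x\in\Delta^n\}\subset L^\infty[0,1]$; each element of $D_n$ is represented by a function $[0,1]\to\{1,-1\}$ with at most $n$ sign changes. Theorem. For any real-valued $f_1,\dots,f_n\in L^1[0,1]$ there exists $\sigma\in D_n$ such that $$\int_0^1\sigma(t)f_i(t)\,dt=0\qquad\text{for all } i=1,\dots,n.$$ -/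

import Mathlib

open MeasureTheory
open scoped ENNReal

noncomputable section

namespace SwitchFunctions

/-- Lebesgue measure on the interval `[0,1]`. -/
abbrev unitMeasure : Measure ℝ := volume.restrict (Set.Icc (0 : ℝ) 1)

/-- The space `L^1[0,1]` of classes of real-valued integrable functions. -/
abbrev LOne : Type := Lp ℝ 1 unitMeasure

/-- The space `L^∞[0,1]` of classes of real-valued essentially bounded functions. -/
abbrev LInfty : Type := Lp ℝ ∞ unitMeasure

/-- The pairing `⟨f, σ⟩ = ∫_0^1 σ(t) f(t) dt`. -/
def pairing (f σ : ℝ → ℝ) : ℝ := ∫ t in (0 : ℝ)..1, σ t * f t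

/-- `σ` and `f` are orthogonal if `⟨f, σ⟩ = 0`. -/
def Orthogonal (f σ : ℝ → ℝ) : Prop := pairing f σ = 0

/-- The standard simplex `{x ∈ ℝ^n | 0 ≤ x_1 ≤ x_2 ≤ ⋯ ≤ x_n ≤ 1}`
(the coordinate `x_(i+1)` is `x i`, for `i : Fin n`). -/
def simplex (n : ℕ) : Set (Fin n → ℝ) := {x | Monotone x ∧ ∀ i, 0 ≤ x i ∧ x i ≤ 1}

/-- The function with value `(-1)^m` at `t`, where `m` is the number of coordinates of `x` that
are at most `t`. For `x` in the simplex, this is the function equal to `(-1)^m` on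
`[x_m, x_(m+1))` for `0 ≤ m ≤ n`, where `x_0 = 0` and `x_(n+1) = 1`, and to `(-1)^n` at `1`;
see `switchFun_eq` and `switchFun_one`. -/
def switchFun {n : ℕ} (x : Fin n → ℝ) (t : ℝ) : ℝ :=
  (-1) ^ (Finset.univ.filter (fun i : Fin n => x i ≤ t)).card

/-- The points `x_0 = 0, x_1, …, x_n, x_(n+1) = 1`. -/
def knot {n : ℕ} (x : Fin n → ℝ) (m : ℕ) : ℝ :=
  if m = 0 then 0 else if h : m - 1 < n then x ⟨m - 1, h⟩ else 1

theorem switchFun_eq {n : ℕ} {x : Fin n → ℝ} (hx : x ∈ simplex n) {m : ℕ} (hm : m ≤ n) {t : ℝ}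
    (h1 : knot x m ≤ t) (h2 : t < knot x (m + 1)) : switchFun x t = (-1) ^ m := by
  have key : Finset.univ.filter (fun i : Fin n => x i ≤ t)
      = Finset.univ.filter (fun i : Fin n => (i : ℕ) < m) := by
    ext i
    simp only [Finset.mem_filter, Finset.mem_univ, true_and]
    constructor
    · intro hi
      by_contra hc
      have hmn : m < n := by omega
      have h3 : knot x (m + 1) = x ⟨m, hmn⟩ := by simp [knot, hmn]
      have h4 : x ⟨m, hmn⟩ ≤ x i := hx.1 (Fin.le_def.2 (by simpa using hc))
      linarith
    · intro hi
      have hmn : m - 1 < n := by omega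
      have h3 : knot x m = x ⟨m - 1, hmn⟩ := by
        simp [knot, hmn, show m ≠ 0 by omega]
      have h4 : x i ≤ x ⟨m - 1, hmn⟩ := hx.1 (Fin.le_def.2 (by simp; omega))
      linarith
  unfold switchFun
  rw [key, Fin.card_filter_val_lt, min_eq_right hm]

theorem switchFun_one {n : ℕ} {x : Fin n → ℝ} (hx : x ∈ simplex n) :
    switchFun x 1 = (-1) ^ n := by
  unfold switchFun
  rw [Finset.filter_true_of_mem (fun i _ => (hx.2 i).2)]
  simp

theorem memLp_switchFun {n : ℕ} (x : Fin n → ℝ) : MemLp (switchFun x) ∞ unitMeasure := by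
  have hmeas : Measurable (switchFun x) := by
    have h : switchFun x = fun t => ∏ i : Fin n, if x i ≤ t then (-1 : ℝ) else 1 := by
      funext t
      simp [switchFun, Finset.prod_ite]
    rw [h]
    exact Finset.measurable_fun_prod _ fun i _ =>
      Measurable.ite measurableSet_Ici measurable_const measurable_const
  exact memLp_top_of_bound hmeas.aestronglyMeasurable 1
    (Filter.Eventually.of_forall fun t => by simp [switchFun])

/-- The class `Σ_n(x)` in `L^∞[0,1]` of the function `switchFun x`. -/
def switchClass {n : ℕ} (x : Fin n → ℝ) : LInfty := (memLp_switchFun x).toLp (switchFun x)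

/-- `D_n`, the image of the simplex under `Σ_n`, a subset of `L^∞[0,1]`. -/
def D (n : ℕ) : Set LInfty := switchClass '' simplex n

end SwitchFunctions

end

/-!
This is the Hobby–Rice theorem. The pairings with `f₁, …, fₙ` form a continuous map from the compact
simplex to `ℝⁿ`, so it is enough to make them arbitrarily small. Cut `[0, 1]` into `N` equal blocks,
with `N` so large that the vectors `c b` of the integrals over the blocks are small
(`eventually_norm_integral_le`). Switching functions with switches at the ends of blocks pair with
the `f i` like sequences of signs (`pairingVector_div`), and the claim becomes discrete: some
signed sum `± c 0 ± ⋯ ± c (N - 1)` with at most `n` changes of sign is small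
(`exists_norm_signedSum_le`).

The discrete claim is proved by the parity argument behind the lemmas of Tucker and Fan, carried
out in the language of chains and cochains mod 2, so that no triangulation has to be described. The
simplices are lists of signed sums. The `k`-chain `C k`, known through the evaluation `evalChain` of
cochains, is built from the blocks by means of prisms. It is a fine subdivision of the hemisphere of
sign patterns with at most `k` changes of sign that begin with `+`, and its boundary is the sum of
`C (k - 1)` and of its antipode (`evalChain_coboundary`). Label a vector by the index and the sign
of a coordinate of largest absolute value. If all signed sums were large, then no simplex would
have two opposite labels, its vertices being close to each other. By Fan's identity
(`coboundary_fan`) the number of simplices of `C k` with alternating labels would then have the same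
parity for all `k ≤ n`. But it is `1` for `k = 0` and `0` for `k = n`, since `n + 1` alternating
labels need `n + 1` distinct indices.
-/

namespace HobbyRice

/-! ### Cochains on lists of points -/

section Cochains

variable {V W : Type*}

/-- The coboundary of a mod 2 cochain `φ`: the sum of the values of `φ` at the lists obtained from
the given one by deleting one entry. -/
def coboundary : (List V → ZMod 2) → List V → ZMod 2
  | _, [] => 0
  | φ, w :: l => φ l + coboundary (fun m => φ (w :: m)) l

/-- The dual of the prism operator between the maps `a` and `b`: the sum of the values of `φ` at the
lists `a w₀, …, a wᵢ, b wᵢ, …, b wₖ`. -/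
def prism (a b : V → W) : (List W → ZMod 2) → List V → ZMod 2
  | _, [] => 0
  | φ, w :: l => φ (a w :: b w :: l.map b) + prism a b (fun m => φ (a w :: m)) l

theorem coboundary_zero (l : List V) : coboundary (fun _ => 0) l = 0 := by
  induction l with
  | nil => rfl
  | cons w l ih => simpa [coboundary] using ih

theorem coboundary_add (φ ψ : List V → ZMod 2) (l : List V) :
    coboundary (φ + ψ) l = coboundary φ l + coboundary ψ l := by
  induction l generalizing φ ψ with
  | nil => simp [coboundary]
  | cons w l ih =>
    have := ih (fun m => φ (w :: m)) (fun m => ψ (w :: m))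
    simp only [coboundary, Pi.add_apply]
    rw [show (fun m => φ (w :: m) + ψ (w :: m))
      = (fun m => φ (w :: m)) + fun m => ψ (w :: m) from rfl, this]
    ring

theorem prism_add (a b : V → W) (φ ψ : List W → ZMod 2) (l : List V) :
    prism a b (φ + ψ) l = prism a b φ l + prism a b ψ l := by
  induction l generalizing φ ψ with
  | nil => simp [prism]
  | cons w l ih =>
    have := ih (fun m => φ (a w :: m)) (fun m => ψ (a w :: m))
    simp only [prism, Pi.add_apply]
    rw [show (fun m => φ (a w :: m) + ψ (a w :: m))
      = (fun m => φ (a w :: m)) + fun m => ψ (a w :: m) from rfl, this]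
    ring

theorem coboundary_map (g : V → W) (φ : List W → ZMod 2) (l : List V) :
    coboundary (fun m => φ (m.map g)) l = coboundary φ (l.map g) := by
  induction l generalizing φ with
  | nil => rfl
  | cons w l ih => simp only [coboundary, List.map_cons, ih (fun m => φ (g w :: m))]

theorem coboundary_congr {φ ψ : List V → ZMod 2} {l : List V}
    (h : ∀ m, m.Sublist l → φ m = ψ m) : coboundary φ l = coboundary ψ l := by
  induction l generalizing φ ψ with
  | nil => rfl
  | cons w l ih =>
    simp only [coboundary]
    rw [h l (List.sublist_cons_self w l), ih fun m hm => h _ (hm.cons_cons w)]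

theorem coboundary_perm {φ : List V → ZMod 2} (h : ∀ l m, l.Perm m → φ l = φ m) {l m : List V}
    (hlm : l.Perm m) : coboundary φ l = coboundary φ m := by
  induction hlm generalizing φ with
  | nil => rfl
  | cons w hlm ih =>
    simp only [coboundary]
    rw [h _ _ hlm, ih fun _ _ hp => h _ _ (hp.cons w)]
  | swap v w l =>
    simp only [coboundary]
    rw [show (fun m => φ (w :: v :: m)) = fun m => φ (v :: w :: m) from
      funext fun m => h _ _ (List.Perm.swap v w m)]
    ring
  | trans _ _ ih₁ ih₂ => exact (ih₁ h).trans (ih₂ h)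

theorem prism_congr (a b : V → W) {φ ψ : List W → ZMod 2} {l : List V}
    (h : ∀ m : List W, m.length = l.length + 1 → (∀ g ∈ m, ∃ w ∈ l, g = a w ∨ g = b w) →
      φ m = ψ m) : prism a b φ l = prism a b ψ l := by
  induction l generalizing φ ψ with
  | nil => rfl
  | cons w l ih =>
    simp only [prism]
    rw [h _ (by simp) (by simp; aesop), ih fun m hm hg => h _ (by simp [hm]) ?_]
    intro g hgm
    rcases List.mem_cons.1 hgm with rfl | hgm
    · exact ⟨w, by simp, Or.inl rfl⟩
    · obtain ⟨v, hv, hv'⟩ := hg g hgm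
      exact ⟨v, by simp [hv], hv'⟩

/-- The prism operator is a chain homotopy between the maps of lists induced by `a` and `b`. -/
theorem prism_coboundary (a b : V → W) (φ : List W → ZMod 2) (l : List V) :
    prism a b (coboundary φ) l
      = φ (l.map a) + φ (l.map b) + coboundary (prism a b φ) l := by
  induction l generalizing φ with
  | nil => simp [prism, coboundary, CharTwo.add_self_eq_zero]
  | cons w l ih =>
    have h₁ : prism a b (fun m => coboundary φ (a w :: m)) l
        = prism a b φ l + prism a b (coboundary fun m => φ (a w :: m)) l :=
      prism_add a b φ (coboundary fun m => φ (a w :: m)) l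
    have h₂ : coboundary (fun m => prism a b φ (w :: m)) l
        = coboundary (fun m => φ (a w :: b w :: m)) (l.map b)
          + coboundary (prism a b fun m => φ (a w :: m)) l := by
      rw [← coboundary_map]
      exact coboundary_add (fun m => φ (a w :: b w :: m.map b))
        (prism a b fun m => φ (a w :: m)) l
    simp only [prism, coboundary, List.map_cons] at h₁ h₂ ⊢
    rw [h₁, h₂, ih fun m => φ (a w :: m)]
    linear_combination (CharTwo.add_self_eq_zero (φ (a w :: l.map b)))

theorem prism_concat (a b : V → W) (φ : List W → ZMod 2) (l : List V) (w : V) :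
    prism a b φ (l ++ [w])
      = φ (l.map a ++ [a w, b w]) + prism a b (fun m => φ (m ++ [b w])) l := by
  induction l generalizing φ with
  | nil => simp [prism]
  | cons v l ih =>
    simp only [prism, List.cons_append, List.map_cons, List.map_append, List.map_nil, ih]
    ring

/-- If the maps `σ` and `τ` interchange `a` and `b`, then they interchange the two ends of a prism,
whence the reversal of the lists. -/
theorem prism_reverse {a b : V → W} {σ : V → V} {τ : W → W} (ha : ∀ w, a (σ w) = τ (b w))
    (hb : ∀ w, b (σ w) = τ (a w)) (φ : List W → ZMod 2) (l : List V) :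
    prism a b φ (l.map σ).reverse = prism a b (fun m => φ (m.map τ).reverse) l := by
  induction l generalizing φ with
  | nil => rfl
  | cons w l ih =>
    rw [List.map_cons, List.reverse_cons, prism_concat, ih]
    simp [prism, ha, hb, Function.comp_def]

end Cochains

/-! ### The chain of alternating sign patterns -/

section Chain

variable {E : Type*} [AddCommGroup E] (c : ℕ → E)

/-- Shift by the `N`-th vector, with the sign `(-1) ^ k`. -/
def shift (k N : ℕ) (g : E) : E := g + (-1 : ℤ) ^ k • c N

/-- Evaluation of a cochain on a `k`-chain mod 2 whose vertices are signed sums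
`± c 0 ± ⋯ ± c (N - 1)` with at most `k` sign changes (the signs before the first change
being `+`). The chain for `N + 1` vectors consists of the chain for `N` vectors followed by the
sign `(-1) ^ k`, and of the prism over the `(k-1)`-chain for `N` vectors in which the last sign
goes from `+` to `-`. -/
def evalChain : ℕ → ℕ → (List E → ZMod 2) → ZMod 2
  | 0, 0, φ => φ [0]
  | _ + 1, 0, _ => 0
  | 0, N + 1, φ => evalChain 0 N fun l => φ (l.map (shift c 0 N))
  | k + 1, N + 1, φ => evalChain (k + 1) N (fun l => φ (l.map (shift c (k + 1) N)))
      + evalChain k N (prism (shift c 0 N) (shift c 1 N) φ)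

theorem evalChain_add (k N : ℕ) (φ ψ : List E → ZMod 2) :
    evalChain c k N (φ + ψ) = evalChain c k N φ + evalChain c k N ψ := by
  induction N generalizing k φ ψ with
  | zero => cases k <;> simp [evalChain]
  | succ N ih =>
    have h (k : ℕ) := ih k (fun l => φ (l.map (shift c k N))) (fun l => ψ (l.map (shift c k N)))
    cases k with
    | zero => exact h 0
    | succ k =>
      simp only [evalChain]
      rw [show prism (shift c 0 N) (shift c 1 N) (φ + ψ)
        = prism (shift c 0 N) (shift c 1 N) φ + prism (shift c 0 N) (shift c 1 N) ψ from
        funext fun l => prism_add _ _ _ _ _, ih k]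
      have := h (k + 1)
      simp only [Pi.add_def] at this ⊢
      rw [this]
      ring

theorem evalChain_zero_coboundary (N : ℕ) (φ : List E → ZMod 2) :
    evalChain c 0 N (coboundary φ) = φ [] := by
  induction N generalizing φ with
  | zero => simp [evalChain, coboundary]
  | succ N ih =>
    simp only [evalChain, ← coboundary_map]
    exact ih _

/-- The boundary of the `(k+1)`-chain is the sum of the `k`-chain and of its antipode. -/
theorem evalChain_coboundary (k N : ℕ) (φ : List E → ZMod 2) :
    evalChain c (k + 1) N (coboundary φ)
      = evalChain c k N (φ + fun l => φ (l.map Neg.neg).reverse) := by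
  induction N generalizing k φ with
  | zero => cases k <;> simp [evalChain, CharTwo.add_self_eq_zero]
  | succ N ih =>
    -- the antipode exchanges the two parities of the last sign
    have hneg (j : ℕ) (g : E) : shift c (j + 1) N (-g) = -shift c j N g := by
      simp [shift, pow_succ]; abel
    have hneg' (j : ℕ) (g : E) : shift c j N (-g) = -shift c (j + 1) N g := by
      simp [shift, pow_succ]; abel
    have hpar : (shift c 0 N = shift c k N ∧ shift c 1 N = shift c (k + 1) N) ∨
        (shift c 0 N = shift c (k + 1) N ∧ shift c 1 N = shift c k N) := by
      rcases Nat.even_or_odd k with h | h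
      · left; constructor <;> funext g <;> simp [shift, pow_succ, h.neg_one_pow]
      · right; constructor <;> funext g <;> simp [shift, pow_succ, h.neg_one_pow]
    have hsum : evalChain c k N (fun l => φ (l.map (shift c 0 N)))
        + evalChain c k N (fun l => φ (l.map (shift c 1 N)))
        = evalChain c k N (fun l => φ (l.map (shift c k N)))
        + evalChain c k N (fun l => φ (l.map (shift c (k + 1) N))) := by
      rcases hpar with ⟨h₀, h₁⟩ | ⟨h₀, h₁⟩
      · rw [h₀, h₁]
      · rw [h₀, h₁, add_comm]
    have hprism : prism (shift c 0 N) (shift c 1 N) (coboundary φ)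
        = ((fun l => φ (l.map (shift c 0 N))) + fun l => φ (l.map (shift c 1 N)))
          + coboundary (prism (shift c 0 N) (shift c 1 N) φ) :=
      funext fun l => prism_coboundary _ _ _ _
    have hanti : (fun l : List E => φ ((l.map Neg.neg).reverse.map (shift c (k + 1) N)))
        = fun l => φ ((l.map (shift c k N)).map Neg.neg).reverse := by
      funext l
      simp [Function.comp_def, hneg]
    have hmain : evalChain c (k + 1) (N + 1) (coboundary φ)
        = evalChain c k N (fun l => φ (l.map (shift c k N)))
          + evalChain c k N (fun l => φ ((l.map (shift c k N)).map Neg.neg).reverse)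
          + evalChain c k N (coboundary (prism (shift c 0 N) (shift c 1 N) φ)) := by
      simp only [evalChain, ← coboundary_map]
      rw [show (fun l => coboundary (fun m => φ (m.map (shift c (k + 1) N))) l)
        = coboundary (fun m => φ (m.map (shift c (k + 1) N))) from rfl, ih, hprism,
        evalChain_add, evalChain_add, evalChain_add, hsum, hanti]
      linear_combination CharTwo.add_self_eq_zero
        (evalChain c k N (fun l => φ (l.map (shift c (k + 1) N))))
    rw [hmain, evalChain_add]
    cases k with
    | zero => simp [evalChain, evalChain_zero_coboundary, prism]
    | succ k =>
      rw [ih, evalChain_add]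
      simp only [evalChain]
      rw [show prism (shift c 0 N) (shift c 1 N) (fun l => φ (l.map Neg.neg).reverse)
        = fun l => prism (shift c 0 N) (shift c 1 N) φ (l.map Neg.neg).reverse from
        funext fun l => (prism_reverse (hneg' 0) (hneg 0) φ l).symm]
      ring

end Chain

/-! ### Fan's cochain -/

/-- The indicator of the lists of signs that alternate and begin with `s` (or are empty). -/
def alternating : Bool → List Bool → ZMod 2
  | _, [] => 1
  | s, b :: l => if b = s then alternating (!s) l else 0

theorem coboundary_alternating (s : Bool) (l : List Bool) :
    coboundary (alternating s) l = alternating s l + alternating (!s) l := by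
  induction l generalizing s with
  | nil => simp [coboundary, alternating, CharTwo.add_self_eq_zero]
  | cons b l ih =>
    rw [coboundary]
    by_cases hb : b = s
    · rw [show (fun m => alternating s (b :: m)) = alternating (!s) from
        funext fun m => by simp [alternating, hb], ih]
      simp only [alternating, hb, Bool.not_not, if_true, Bool.eq_not_self, if_false]
      linear_combination CharTwo.add_self_eq_zero (alternating s l)
    · rw [show (fun m => alternating s (b :: m)) = fun _ => 0 from
        funext fun m => by simp [alternating, hb], coboundary_zero]
      simp [alternating, Bool.eq_not_of_ne hb]

theorem alternating_map_not (s : Bool) (l : List Bool) :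
    alternating s (l.map not) = alternating (!s) l := by
  induction l generalizing s with
  | nil => rfl
  | cons b l ih => cases b <;> cases s <;> simp [alternating, ih]

/-- A label `±i` of Fan's lemma, encoded by its absolute value `i` and its sign, and ordered by
absolute value first. -/
abbrev Label : Type := ℕ ×ₗ Bool

/-- The absolute value of a label. -/
def Label.index (m : Label) : ℕ := (ofLex m).1

/-- The sign of a label. -/
def Label.sign (m : Label) : Bool := (ofLex m).2

/-- The opposite of a label. -/
def Label.antipode (m : Label) : Label := toLex (m.index, !m.sign)

/-- No two opposite labels occur in the list. -/
def Consistent (l : List Label) : Prop :=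
  ∀ m ∈ l, ∀ m' ∈ l, m.index = m'.index → m.sign = m'.sign

/-- Fan's cochain: the indicator of the lists of labels whose signs alternate, beginning with `s`,
when the labels are sorted. -/
def fan (s : Bool) (l : List Label) : ZMod 2 :=
  alternating s ((l.insertionSort (· ≤ ·)).map Label.sign)

theorem fan_perm (s : Bool) {l m : List Label} (h : l.Perm m) : fan s l = fan s m := by
  have : l.insertionSort (· ≤ ·) = m.insertionSort (· ≤ ·) :=
    ((List.perm_insertionSort _ l).trans
      (h.trans (List.perm_insertionSort _ m).symm)).eq_of_pairwise'
      (List.pairwise_insertionSort _ l) (List.pairwise_insertionSort _ m)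
  rw [fan, this, fan]

theorem fan_of_pairwise (s : Bool) {l : List Label} (h : l.Pairwise (· ≤ ·)) :
    fan s l = alternating s (l.map Label.sign) := by
  rw [fan, h.insertionSort_eq]

/-- The combinatorial core of Fan's lemma: a simplex has an odd number of positively alternating
facets if and only if it is itself alternating. -/
theorem coboundary_fan (s : Bool) (l : List Label) :
    coboundary (fan s) l = fan s l + fan (!s) l := by
  have hp := List.perm_insertionSort (· ≤ ·) l
  have hs := List.pairwise_insertionSort (· ≤ ·) l
  rw [← coboundary_perm (fun _ _ h => fan_perm s h) hp,
    coboundary_congr fun m hm => fan_of_pairwise s (hs.sublist hm),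
    coboundary_map Label.sign (alternating s), coboundary_alternating]
  rfl

theorem fan_map_antipode (s : Bool) {l : List Label} (h : Consistent l) :
    fan s (l.map Label.antipode) = fan (!s) l := by
  have hp := List.perm_insertionSort (· ≤ ·) l
  have hs := List.pairwise_insertionSort (· ≤ ·) l
  -- opposite labels being absent, the antipode preserves the order of the labels in the list
  have hs' : ((l.insertionSort (· ≤ ·)).map Label.antipode).Pairwise (· ≤ ·) := by
    rw [List.pairwise_map]
    refine hs.imp_of_mem fun {m m'} hm hm' hle => ?_
    have hc := h m (hp.mem_iff.1 hm) m' (hp.mem_iff.1 hm')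
    rw [Prod.Lex.le_iff] at hle ⊢
    rcases hle with hlt | ⟨heq, -⟩
    · exact Or.inl hlt
    · exact Or.inr ⟨heq, le_of_eq (congrArg not (hc heq))⟩
  rw [← fan_perm s (hp.map Label.antipode), fan_of_pairwise s hs', fan, ← alternating_map_not,
    List.map_map, List.map_map]
  rfl

/-- A consistent sorted list with alternating signs has strictly increasing absolute values. -/
theorem pairwise_index_lt {s : Bool} {l : List Label} (hs : l.Pairwise (· ≤ ·))
    (hc : Consistent l) (ha : alternating s (l.map Label.sign) ≠ 0) :
    l.Pairwise fun m m' => m.index < m'.index := by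
  have : IsTrans Label fun m m' => m.index < m'.index := ⟨fun _ _ _ => lt_trans⟩
  rw [← List.isChain_iff_pairwise]
  induction l generalizing s with
  | nil => exact List.IsChain.nil
  | cons m l ih =>
    have hsl := (List.pairwise_cons.1 hs).2
    have hcl : Consistent l := fun a ha b hb => hc a (by simp [ha]) b (by simp [hb])
    simp only [List.map_cons, alternating] at ha
    split_ifs at ha with hm
    · have hch := ih hsl hcl ha
      cases l with
      | nil => exact List.isChain_singleton _
      | cons m' l =>
        refine List.isChain_cons_cons.2 ⟨?_, hch⟩
        have hle := (List.pairwise_cons.1 hs).1 m' (by simp)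
        rw [Prod.Lex.le_iff] at hle
        rcases hle with hlt | ⟨heq, -⟩
        · exact hlt
        · have := hc m (by simp) m' (by simp) heq
          simp [alternating, ← this, hm] at ha
    · exact absurd rfl ha

theorem fan_eq_zero {s : Bool} {n : ℕ} {l : List Label} (hc : Consistent l)
    (hi : ∀ m ∈ l, m.index < n) (hl : n < l.length) : fan s l = 0 := by
  by_contra hne
  have hp := List.perm_insertionSort (· ≤ ·) l
  have hlt := pairwise_index_lt (List.pairwise_insertionSort (· ≤ ·) l)
    (fun a ha b hb => hc a (hp.mem_iff.1 ha) b (hp.mem_iff.1 hb)) hne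
  have hnd : (l.map Label.index).Nodup := by
    rw [← (hp.map Label.index).nodup_iff]
    exact List.pairwise_map.2 (hlt.imp fun h => h.ne)
  have hsub : (l.map Label.index).toFinset ⊆ Finset.range n := fun i hi' => by
    obtain ⟨m, hm, rfl⟩ := List.mem_map.1 (List.mem_toFinset.1 hi')
    exact Finset.mem_range.2 (hi m hm)
  have := Finset.card_le_card hsub
  rw [List.toFinset_card_of_nodup hnd, List.length_map, Finset.card_range] at this
  omega

/-! ### The discrete theorem -/

section Discrete

variable {n : ℕ} (c : ℕ → Fin n → ℝ)

/-- The signed sum `± c 0 ± ⋯ ± c (N - 1)` in which the sign, `+` to begin with, changes just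
before the indices `x i` (repetitions being counted). -/
def signedSum {k : ℕ} (N : ℕ) (x : Fin k → ℕ) : Fin n → ℝ :=
  ∑ b ∈ Finset.range N, (∏ i, if x i ≤ b then (-1 : ℤ) else 1) • c b

/-- The signed sums of `c 0, …, c (N - 1)` with at most `k` changes of sign. -/
def IsSignedSum (k N : ℕ) (g : Fin n → ℝ) : Prop :=
  ∃ x : Fin k → ℕ, Monotone x ∧ (∀ i, x i ≤ N) ∧ g = signedSum c N x

variable {c}

theorem monotone_snoc {k N : ℕ} {x : Fin k → ℕ} (hx : Monotone x) (h : ∀ i, x i ≤ N) :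
    Monotone (Fin.snoc x N : Fin (k + 1) → ℕ) := by
  intro i j hij
  induction j using Fin.lastCases with
  | last =>
    induction i using Fin.lastCases with
    | last => exact le_rfl
    | cast i => simpa using h i
  | cast j =>
    induction i using Fin.lastCases with
    | last => exact absurd hij (by simp [Fin.le_def])
    | cast i => simpa using hx (by simpa using hij)

theorem signedSum_snoc {k N M : ℕ} (x : Fin k → ℕ) (h : N ≤ M) :
    signedSum c N (Fin.snoc x M : Fin (k + 1) → ℕ) = signedSum c N x := by
  refine Finset.sum_congr rfl fun b hb => ?_
  have : ¬ M ≤ b := by have := Finset.mem_range.1 hb; omega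
  simp [Fin.prod_univ_castSucc, this]

theorem IsSignedSum.succ_left {k N : ℕ} {g : Fin n → ℝ} (h : IsSignedSum c k N g) :
    IsSignedSum c (k + 1) N g := by
  obtain ⟨x, hx, hN, rfl⟩ := h
  refine ⟨Fin.snoc x N, monotone_snoc hx hN, fun i => ?_, (signedSum_snoc x le_rfl).symm⟩
  induction i using Fin.lastCases with
  | last => simp
  | cast i => simpa using hN i

theorem IsSignedSum.mono_left {k k' N : ℕ} {g : Fin n → ℝ} (h : IsSignedSum c k N g)
    (hk : k ≤ k') : IsSignedSum c k' N g := by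
  induction hk with
  | refl => exact h
  | step _ ih => exact ih.succ_left

theorem IsSignedSum.shift_self {k N : ℕ} {g : Fin n → ℝ} (h : IsSignedSum c k N g) :
    IsSignedSum c k (N + 1) (shift c k N g) := by
  obtain ⟨x, hx, hN, rfl⟩ := h
  refine ⟨x, hx, fun i => (hN i).trans N.le_succ, ?_⟩
  simp [signedSum, Finset.sum_range_succ, shift, hN]

theorem IsSignedSum.shift_succ {k N : ℕ} {g : Fin n → ℝ} (h : IsSignedSum c k N g) :
    IsSignedSum c (k + 1) (N + 1) (shift c (k + 1) N g) := by
  obtain ⟨x, hx, hN, rfl⟩ := h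
  refine ⟨Fin.snoc x N, monotone_snoc hx hN, fun i => ?_, ?_⟩
  · induction i using Fin.lastCases with
    | last => simp
    | cast i => simpa using (hN i).trans N.le_succ
  · rw [shift, ← signedSum_snoc x le_rfl, signedSum, signedSum, Finset.sum_range_succ]
    simp [Fin.prod_univ_castSucc, hN, pow_succ]

theorem IsSignedSum.shift_zero_or_one {k N : ℕ} {g : Fin n → ℝ} (h : IsSignedSum c k N g) :
    IsSignedSum c (k + 1) (N + 1) (shift c 0 N g) ∧
      IsSignedSum c (k + 1) (N + 1) (shift c 1 N g) := by
  have h₁ := h.shift_self.succ_left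
  have h₂ := h.shift_succ
  rcases Nat.even_or_odd k with hk | hk <;>
  simp only [shift, pow_succ, hk.neg_one_pow] at h₁ h₂ ⊢ <;>
  simp_all

/-- The lists on which the values of a cochain determine its value on the `k`-chain: they have
`k + 1` entries, which are signed sums with at most `k` changes of sign and are close to each
other. -/
def IsSimplex (c : ℕ → Fin n → ℝ) (ε : ℝ) (k N : ℕ) (l : List (Fin n → ℝ)) : Prop :=
  l.length = k + 1 ∧ (∀ g ∈ l, IsSignedSum c k N g) ∧
    ∀ g ∈ l, ∀ g' ∈ l, ‖g - g'‖ ≤ 2 * k * ε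

theorem evalChain_congr {ε : ℝ} {k N : ℕ} (hε : ∀ b < N, ‖c b‖ ≤ ε)
    {φ ψ : List (Fin n → ℝ) → ZMod 2} (h : ∀ l, IsSimplex c ε k N l → φ l = ψ l) :
    evalChain c k N φ = evalChain c k N ψ := by
  induction N generalizing k φ ψ with
  | zero =>
    cases k with
    | zero =>
      exact h _ ⟨rfl, by
        simpa [IsSignedSum, signedSum] using Subsingleton.monotone _, by simp⟩
    | succ k => rfl
  | succ N ih =>
    have hε' : ∀ b < N, ‖c b‖ ≤ ε := fun b hb => hε b (hb.trans N.lt_succ_self)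
    have hshift (k : ℕ) (hk : ∀ l, IsSimplex c ε k (N + 1) l → φ l = ψ l) :
        evalChain c k N (fun l => φ (l.map (shift c k N)))
          = evalChain c k N (fun l => ψ (l.map (shift c k N))) := by
      refine ih hε' fun l hl => hk _ ⟨by simpa using hl.1, ?_, ?_⟩
      · intro g hg
        obtain ⟨w, hw, rfl⟩ := List.mem_map.1 hg
        exact (hl.2.1 w hw).shift_self
      · intro g hg g' hg'
        obtain ⟨w, hw, rfl⟩ := List.mem_map.1 hg
        obtain ⟨w', hw', rfl⟩ := List.mem_map.1 hg'
        simpa [shift] using hl.2.2 w hw w' hw'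
    cases k with
    | zero => exact hshift 0 h
    | succ k =>
      simp only [evalChain]
      rw [hshift _ h]
      congr 1
      refine ih hε' fun l hl => prism_congr _ _ fun m hm hmem => h m ⟨by rw [hm, hl.1], ?_, ?_⟩
      · intro g hg
        obtain ⟨w, hw, rfl | rfl⟩ := hmem g hg
        · exact (hl.2.1 w hw).shift_zero_or_one.1
        · exact (hl.2.1 w hw).shift_zero_or_one.2
      · have hc := hε N N.lt_succ_self
        have key (g : Fin n → ℝ) (hg : g ∈ m) : ∃ w ∈ l, ‖g - w‖ ≤ ε := by
          obtain ⟨w, hw, rfl | rfl⟩ := hmem g hg <;> exact ⟨w, hw, by simpa [shift] using hc⟩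
        intro g hg g' hg'
        obtain ⟨w, hw, hgw⟩ := key g hg
        obtain ⟨w', hw', hgw'⟩ := key g' hg'
        calc ‖g - g'‖ = ‖(g - w) + (w - w') - (g' - w')‖ := by congr 1; abel
          _ ≤ ‖g - w‖ + ‖w - w'‖ + ‖g' - w'‖ :=
            (norm_sub_le _ _).trans (by gcongr; exact norm_add_le _ _)
          _ ≤ ε + 2 * k * ε + ε := by gcongr; exact hl.2.2 w hw w' hw'
          _ = 2 * (k + 1 : ℕ) * ε := by push_cast; ring

theorem evalChain_zero_of_singleton {N : ℕ} {φ : List (Fin n → ℝ) → ZMod 2} {a : ZMod 2}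
    (h : ∀ g, φ [g] = a) : evalChain c 0 N φ = a := by
  induction N generalizing φ with
  | zero => exact h 0
  | succ N ih => exact ih fun g => h _

/-- An index of a coordinate of largest absolute value, as a function of the absolute values
(and `0` if there are no coordinates). -/
noncomputable def maxIndex (h : Fin n → ℝ) : ℕ :=
  open Classical in if H : ∃ i, ∀ j, h j ≤ h i then (H.choose : ℕ) else 0

/-- The label of a vector: the index and the sign of a coordinate of largest absolute value. -/
noncomputable def label (g : Fin n → ℝ) : Label :=
  open Classical in
  toLex (maxIndex fun i => |g i|,
    decide (∃ i : Fin n, (i : ℕ) = maxIndex (fun i => |g i|) ∧ 0 < g i))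

theorem label_spec {g : Fin n → ℝ} (hg : g ≠ 0) :
    ∃ i : Fin n, (label g).index = i ∧ |g i| = ‖g‖ ∧ ((label g).sign = true ↔ 0 < g i) := by
  have hne : Nonempty (Fin n) := by
    by_contra h
    exact hg (funext fun i => (h ⟨i⟩).elim)
  have H : ∃ i, ∀ j, |g j| ≤ |g i| := Finite.exists_max _
  have hi : maxIndex (fun i => |g i|) = H.choose := by simp only [maxIndex, dif_pos H]
  refine ⟨H.choose, hi, le_antisymm (norm_le_pi_norm g _)
    ((pi_norm_le_iff_of_nonneg (abs_nonneg _)).2 H.choose_spec), ?_⟩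
  simp [label, Label.sign, hi, Fin.val_inj]

theorem label_neg {g : Fin n → ℝ} (hg : g ≠ 0) : label (-g) = (label g).antipode := by
  have hidx : (label (-g)).index = (label g).index := by simp [label, Label.index]
  obtain ⟨i, hi, hn, hs⟩ := label_spec hg
  obtain ⟨j, hj, hn', hs'⟩ := label_spec (neg_ne_zero.2 hg)
  obtain rfl : i = j := Fin.ext (by rw [← hi, ← hj, hidx])
  have hgi : g i ≠ 0 := fun h => by rw [h, abs_zero] at hn; exact hg (norm_eq_zero.1 hn.symm)
  have hsign : (label (-g)).sign = !(label g).sign := by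
    rw [Bool.eq_iff_iff, hs', Bool.not_eq_true', ← Bool.not_eq_true, hs]
    simp only [Pi.neg_apply, Left.neg_pos_iff, not_lt]
    exact ⟨le_of_lt, fun h => lt_of_le_of_ne h hgi⟩
  exact congrArg toLex (Prod.ext hidx hsign)

/-- A list of vectors that are closer to each other than to the origin has no opposite labels. -/
theorem consistent_map_label {δ : ℝ} {l : List (Fin n → ℝ)} (h₀ : 0 ≤ δ) (h : ∀ g ∈ l, δ < ‖g‖)
    (hd : ∀ g ∈ l, ∀ g' ∈ l, ‖g - g'‖ ≤ δ) : Consistent (l.map label) := by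
  intro m hm m' hm' hidx
  obtain ⟨g, hg, rfl⟩ := List.mem_map.1 hm
  obtain ⟨g', hg', rfl⟩ := List.mem_map.1 hm'
  obtain ⟨i, hi, hn, hs⟩ := label_spec (norm_pos_iff.1 (h₀.trans_lt (h g hg)))
  obtain ⟨j, hj, hn', hs'⟩ := label_spec (norm_pos_iff.1 (h₀.trans_lt (h g' hg')))
  obtain rfl : i = j := Fin.ext (by rw [← hi, ← hj, hidx])
  have hdi := (norm_le_pi_norm (g - g') i).trans (hd g hg g' hg')
  have h₁ := h g hg
  have h₂ := h g' hg'
  rw [← hn] at h₁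
  rw [← hn'] at h₂
  rw [Bool.eq_iff_iff, hs, hs']
  rw [Real.norm_eq_abs, Pi.sub_apply, abs_le] at hdi
  rcases lt_abs.1 h₁ with h₁ | h₁ <;> rcases lt_abs.1 h₂ with h₂ | h₂ <;>
    constructor <;> intro _ <;> linarith

/-- **Discrete Hobby–Rice theorem**: for small vectors `c 0, …, c (N - 1)` in `ℝ ^ n` there is a
small signed sum with at most `n` changes of sign. -/
theorem exists_norm_signedSum_le {N : ℕ} {ε : ℝ} (h₀ : 0 ≤ ε) (hε : ∀ b < N, ‖c b‖ ≤ ε) :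
    ∃ x : Fin n → ℕ, Monotone x ∧ (∀ i, x i ≤ N) ∧ ‖signedSum c N x‖ ≤ 2 * n * ε := by
  by_contra! hcon
  have hbig {k : ℕ} (hk : k ≤ n) (g : Fin n → ℝ) (hg : IsSignedSum c k N g) :
      2 * n * ε < ‖g‖ := by
    obtain ⟨x, hx, hN, rfl⟩ := hg.mono_left hk
    exact hcon x hx hN
  have hpos : 0 ≤ 2 * n * ε := by positivity
  have hcons {k : ℕ} (hk : k ≤ n) {l : List (Fin n → ℝ)} (hl : IsSimplex c ε k N l) :
      Consistent (l.map label) :=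
    consistent_map_label hpos (fun g hg => hbig hk g (hl.2.1 g hg))
      fun g hg g' hg' => (hl.2.2 g hg g' hg').trans (by gcongr)
  let φ (s : Bool) (l : List (Fin n → ℝ)) : ZMod 2 := fan s (l.map label)
  -- the number of alternating simplices of the `k`-chain is odd
  have hodd (k : ℕ) (hk : k ≤ n) : evalChain c k N (φ true + φ false) = 1 := by
    induction k with
    | zero =>
      refine evalChain_zero_of_singleton fun g => ?_
      simp only [φ, Pi.add_apply, fan, List.map_cons, List.map_nil, List.insertionSort_cons,
        List.insertionSort_nil, List.orderedInsert_nil]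
      cases (label g).sign <;> simp [alternating]
    | succ k ih =>
      have hcob : φ true + φ false = coboundary (φ true) := funext fun l => by
        rw [coboundary_map, coboundary_fan]; rfl
      rw [hcob, evalChain_coboundary, ← ih (by omega)]
      refine evalChain_congr hε fun l hl => ?_
      have hneg : (l.map Neg.neg).map label = (l.map label).map Label.antipode := by
        simp only [List.map_map]
        refine List.map_congr_left fun g hg => label_neg ?_
        exact norm_pos_iff.1 (hpos.trans_lt (hbig (by omega) g (hl.2.1 g hg)))
      simp only [φ, Pi.add_apply, List.map_reverse]
      rw [fan_perm true (List.reverse_perm _), hneg,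
        fan_map_antipode true (hcons (by omega) hl)]
      rfl
  -- but an alternating `n`-simplex has `n + 1` labels with distinct absolute values
  have hzero : evalChain c n N (φ true + φ false) = evalChain c n N 0 := by
    refine evalChain_congr hε fun l hl => ?_
    have hidx : ∀ m ∈ l.map label, m.index < n := fun m hm => by
      obtain ⟨g, hg, rfl⟩ := List.mem_map.1 hm
      obtain ⟨i, hi, -⟩ :=
        label_spec (norm_pos_iff.1 (hpos.trans_lt (hbig le_rfl g (hl.2.1 g hg))))
      omega
    have hlen : n < (l.map label).length := by rw [List.length_map, hl.1]; omega
    simp [φ, fan_eq_zero (hcons le_rfl hl) hidx hlen]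
  have hz := evalChain_add c n N 0 0
  rw [hodd n le_rfl] at hzero
  rw [add_zero, ← hzero] at hz
  exact absurd hz (by decide)

end Discrete

open SwitchFunctions

/-! ### Integrals against switching functions -/

theorem switchFun_eq_prod {n : ℕ} (x : Fin n → ℝ) (t : ℝ) :
    switchFun x t = ∏ i : Fin n, if x i ≤ t then (-1 : ℝ) else 1 := by
  simp [switchFun, Finset.prod_ite]

theorem norm_switchFun {n : ℕ} (x : Fin n → ℝ) (t : ℝ) : ‖switchFun x t‖ = 1 := by
  simp [switchFun]

theorem measurable_switchFun {n : ℕ} (x : Fin n → ℝ) : Measurable (switchFun x) := by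
  rw [funext (switchFun_eq_prod x)]
  exact Finset.measurable_fun_prod _ fun i _ =>
    Measurable.ite measurableSet_Ici measurable_const measurable_const

theorem continuousAt_switchFun {n : ℕ} {x : Fin n → ℝ} {t : ℝ} (h : ∀ i, x i ≠ t) :
    ContinuousAt (fun y : Fin n → ℝ => switchFun y t) x := by
  simp only [switchFun_eq_prod]
  refine tendsto_finsetProd _ fun i _ => ?_
  have hi : ContinuousAt (fun y : Fin n → ℝ => y i) x := (continuous_apply i).continuousAt
  rcases lt_or_gt_of_ne (h i) with hlt | hlt
  · refine Filter.Tendsto.congr' ?_ tendsto_const_nhds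
    filter_upwards [hi.eventually (gt_mem_nhds hlt)] with y hy
    simp [hlt.le, hy.le]
  · refine Filter.Tendsto.congr' ?_ tendsto_const_nhds
    filter_upwards [hi.eventually (lt_mem_nhds hlt)] with y hy
    simp [hlt.not_ge, hy.not_ge]

variable {n : ℕ} {f : Fin n → ℝ → ℝ}

/-- The vector of the pairings of the functions `f i` with the switching function of `x`. -/
noncomputable def pairingVector (f : Fin n → ℝ → ℝ) (x : Fin n → ℝ) : Fin n → ℝ :=
  fun i => pairing (f i) (switchFun x)

theorem continuous_pairingVector (hf : ∀ i, IntervalIntegrable (f i) volume 0 1) :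
    Continuous (pairingVector f) := by
  refine continuous_pi fun i => continuous_iff_continuousAt.2 fun x => ?_
  refine intervalIntegral.continuousAt_of_dominated_interval (bound := fun t => ‖f i t‖)
    (.of_forall fun y => ?_) (.of_forall fun y => .of_forall fun t _ => ?_) (hf i).norm ?_
  · exact (measurable_switchFun y).aestronglyMeasurable.mul (hf i).def'.aestronglyMeasurable
  · rw [norm_mul, norm_switchFun, one_mul]
  · have hx : ∀ᵐ t : ℝ, t ∉ Set.range x := 
      compl_mem_ae_iff.2 ((Set.finite_range x).measure_zero volume)
    filter_upwards [hx] with t ht _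
    exact (continuousAt_switchFun fun i hi => ht ⟨i, hi⟩).mul continuousAt_const

theorem isCompact_simplex (n : ℕ) : IsCompact (simplex n) := by
  refine (isCompact_Icc (a := (0 : Fin n → ℝ)) (b := 1)).of_isClosed_subset ?_
    fun x hx => ⟨fun i => (hx.2 i).1, fun i => (hx.2 i).2⟩
  simp only [simplex, Monotone, Set.ofPred_and, Set.ofPred_forall]
  refine IsClosed.inter ?_ ?_
  · exact isClosed_iInter fun i => isClosed_iInter fun j => isClosed_iInter fun _ =>
      isClosed_le (continuous_apply i) (continuous_apply j)
  · exact isClosed_iInter fun i => (isClosed_le continuous_const (continuous_apply i)).inter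
      (isClosed_le (continuous_apply i) continuous_const)

/-- An integrable function has small integrals over all intervals of a sufficiently fine uniform
subdivision of `[0, 1]`. -/
theorem eventually_norm_integral_le {g : ℝ → ℝ} (hg : IntervalIntegrable g volume 0 1) {ε : ℝ}
    (hε : 0 < ε) :
    ∀ᶠ N : ℕ in Filter.atTop, ∀ b < N, ‖∫ t in (b / N : ℝ)..((b + 1 : ℕ) / N : ℝ), g t‖ ≤ ε := by
  have hc := intervalIntegral.continuousOn_primitive_interval
    ((intervalIntegrable_iff_integrableOn_Icc_of_le zero_le_one).1 hg |>.mono_set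
      (Set.uIcc_of_le zero_le_one).subset)
  rw [Set.uIcc_of_le zero_le_one] at hc
  obtain ⟨δ, hδ, h⟩ := Metric.uniformContinuousOn_iff_le.1
    (isCompact_Icc.uniformContinuousOn_of_continuous hc) ε hε
  have hlim : ∀ᶠ N : ℕ in Filter.atTop, 1 / (N : ℝ) < δ :=
    (tendsto_one_div_atTop_nhds_zero_nat (𝕜 := ℝ)).eventually (gt_mem_nhds hδ)
  filter_upwards [hlim] with N hN b hb
  have hN₀ : (0 : ℝ) < N := by exact_mod_cast (Nat.zero_le b).trans_lt hb
  have hmem (a : ℕ) (ha : a ≤ N) : (a / N : ℝ) ∈ Set.Icc (0 : ℝ) 1 :=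
    ⟨by positivity, (div_le_one hN₀).2 (by exact_mod_cast ha)⟩
  have hint (a : ℕ) (ha : a ≤ N) : IntervalIntegrable g volume 0 (a / N : ℝ) :=
    hg.mono_set (by
      rw [Set.uIcc_of_le (hmem a ha).1, Set.uIcc_of_le zero_le_one]
      exact Set.Icc_subset_Icc_right (hmem a ha).2)
  have := h _ (hmem (b + 1) hb) _ (hmem b hb.le) ?_
  · rwa [dist_eq_norm, intervalIntegral.integral_interval_sub_left (hint _ hb) (hint _ hb.le)]
      at this
  · rw [Real.dist_eq, ← sub_div, Nat.cast_succ, add_sub_cancel_left, abs_of_pos (by positivity)]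
    exact hN.le

/-- Switching functions that switch at multiples of `1 / N` pair with `f` like sequences of
signs. -/
theorem pairingVector_div (hf : ∀ i, IntervalIntegrable (f i) volume 0 1) {N : ℕ} (hN : 0 < N)
    (x : Fin n → ℕ) :
    pairingVector f (fun i => (x i / N : ℝ))
      = signedSum (fun b i => ∫ t in (b / N : ℝ)..((b + 1 : ℕ) / N : ℝ), f i t) N x := by
  have hN₀ : (0 : ℝ) < N := by exact_mod_cast hN
  funext i
  have hsub (b : ℕ) (hb : b < N) :
      Set.uIcc (b / N : ℝ) ((b + 1 : ℕ) / N : ℝ) ⊆ Set.uIcc 0 1 := by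
    rw [Set.uIcc_of_le (by gcongr; simp), Set.uIcc_of_le zero_le_one]
    exact Set.Icc_subset_Icc (by positivity) ((div_le_one hN₀).2 (by exact_mod_cast hb))
  have hint : IntervalIntegrable (fun t => switchFun (fun i => (x i / N : ℝ)) t * f i t)
      volume 0 1 := by
    rw [intervalIntegrable_iff]
    exact (intervalIntegrable_iff.1 (hf i)).bdd_mul (measurable_switchFun _).aestronglyMeasurable
      (.of_forall fun t => (norm_switchFun _ t).le)
  have hadj := intervalIntegral.sum_integral_adjacent_intervals (a := fun b : ℕ => (b / N : ℝ))
    fun b hb => hint.mono_set (hsub b hb)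
  simp only [Nat.cast_zero, zero_div, div_self hN₀.ne'] at hadj
  rw [pairingVector, pairing, ← hadj, signedSum, Finset.sum_apply]
  refine Finset.sum_congr rfl fun b hb => ?_
  have hconst : ∀ t ∈ Set.Ioo (b / N : ℝ) ((b + 1 : ℕ) / N : ℝ),
      switchFun (fun i => (x i / N : ℝ)) t = ((∏ i, if x i ≤ b then (-1 : ℤ) else 1 : ℤ) : ℝ) := by
    intro t ht
    rw [switchFun_eq_prod, Int.cast_prod]
    refine Finset.prod_congr rfl fun j _ => ?_
    have : (x j / N : ℝ) ≤ t ↔ x j ≤ b := by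
      constructor
      · intro h
        have h' := (div_lt_div_iff_of_pos_right hN₀).1 (h.trans_lt ht.2)
        exact Nat.lt_succ_iff.1 (by exact_mod_cast h')
      · intro h
        exact le_trans (by gcongr) ht.1.le
    simp only [this]
    split_ifs <;> simp
  rw [Pi.smul_apply, zsmul_eq_mul, ← intervalIntegral.integral_const_mul]
  refine intervalIntegral.integral_congr_ae ?_
  rw [Set.uIoc_of_le (by gcongr; simp)]
  have hne : ∀ᵐ t : ℝ, t ≠ ((b + 1 : ℕ) / N : ℝ) := Measure.ae_ne volume _
  filter_upwards [hne] with t ht htI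
  rw [hconst t ⟨htI.1, lt_of_le_of_ne htI.2 ht⟩]

/-- The **Hobby–Rice theorem** for functions. -/
theorem exists_pairingVector_eq_zero (hf : ∀ i, IntervalIntegrable (f i) volume 0 1) :
    ∃ x ∈ simplex n, pairingVector f x = 0 := by
  have h0 : (0 : Fin n → ℝ) ∈ simplex n := ⟨monotone_const, fun _ => by simp⟩
  obtain ⟨y, hy, hmin⟩ := (isCompact_simplex n).exists_isMinOn ⟨0, h0⟩
    (continuous_pairingVector hf).norm.continuousOn
  refine ⟨y, hy, norm_le_zero_iff.1 (le_of_forall_pos_le_add fun ε hε => ?_)⟩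
  have hδ : 0 < ε / (2 * n + 1) := by positivity
  obtain ⟨N, hN, hN₀⟩ := ((Filter.eventually_all.2 fun i =>
    eventually_norm_integral_le (hf i) hδ).and (Filter.eventually_gt_atTop 0)).exists
  obtain ⟨x, hx, hxN, hle⟩ := exists_norm_signedSum_le
    (c := fun b i => ∫ t in (b / N : ℝ)..((b + 1 : ℕ) / N : ℝ), f i t) hδ.le
    fun b hb => (pi_norm_le_iff_of_nonneg hδ.le).2 fun i => hN i b hb
  have hN₁ : (0 : ℝ) < N := by exact_mod_cast hN₀
  have hmem : (fun i => (x i / N : ℝ)) ∈ simplex n := by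
    refine ⟨fun i j hij => ?_, fun i => ⟨by positivity, ?_⟩⟩
    · have := hx hij
      dsimp only
      gcongr
    · exact (div_le_one hN₁).2 (by exact_mod_cast hxN i)
  calc ‖pairingVector f y‖ ≤ ‖pairingVector f fun i => (x i / N : ℝ)‖ := hmin hmem
    _ ≤ 2 * n * (ε / (2 * n + 1)) := by rw [pairingVector_div hf hN₀]; exact hle
    _ ≤ 0 + ε := by
      rw [zero_add, mul_div_assoc', div_le_iff₀ (by positivity)]
      nlinarith

end HobbyRice

theorem theorem1 (n : ℕ) (f : Fin n → SwitchFunctions.LOne) :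
    ∃ σ ∈ SwitchFunctions.D n, ∀ i : Fin n, SwitchFunctions.Orthogonal (f i) σ := by
  have hf (i : Fin n) : IntervalIntegrable (f i) volume 0 1 :=
    (intervalIntegrable_iff_integrableOn_Icc_of_le zero_le_one).2 (L1.integrable_coeFn (f i))
  obtain ⟨x, hx, h⟩ := HobbyRice.exists_pairingVector_eq_zero hf
  refine ⟨_, ⟨x, hx, rfl⟩, fun i => ?_⟩
  refine Eq.trans ?_ (congrFun h i)
  -- the class of `switchFun x` has `switchFun x` as a representative almost everywhere on `[0, 1]`
  have hae := (ae_restrict_iff' measurableSet_Icc).1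
    (SwitchFunctions.memLp_switchFun x).coeFn_toLp
  refine intervalIntegral.integral_congr_ae ?_
  filter_upwards [hae] with t ht htI
  rw [Set.uIoc_of_le zero_le_one] at htI
  rw [SwitchFunctions.switchClass, ht (Set.Ioc_subset_Icc_self htI)]
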